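/- Let $\mathcal{T}$ be a compactly generated triangulated category: a triangulated category with set-indexed coproducts whose compact objects have only a set of isomorphism classes and such that $Y=0$ whenever $\mathrm{Hom}(X,Y)=0$ for all compact $X$. For an object $M$ and $I\subseteq\mathbb{Z}$ put $M^{\perp_I}=\{Y:\mathrm{Hom}(M,Y[i])=0\ \forall i\in I\}$ and ${}^{\perp_I}M=\{Y:\mathrm{Hom}(Y,M[i])=0\ \forall i\in I\}$. Call $M$ silting if $(M^{\perp_{>0}},M^{\perp_{\le 0}})$ is a t-structure (aisle, coaisle) and $M\in M^{\perp_{>0}}$; call $M$ cosilting if $({}^{\perp_{\le 0}}M,{}^{\perp_{>0}}M)$ is a t-structure and $M\in{}^{\perp_{>0}}M$. Index the associated t-structure cohomologically so that $\mathcal{T}^{\le 0}=M^{\perp_{>0}}$ and $\mathcal{T}^{\ge 1}=M^{\perp_{\le 0}}$ in the silting case, and $\mathcal{T}^{\le -1}={}^{\perp_{\le 0}}M$ and $\mathcal{T}^{\ge 0}={}^{\perp_{>0}}M$ in the cosilting case. Let $\mathcal{H}_M=\mathcal{T}^{\le 0}\cap\mathcal{T}^{\ge 0}$ be its heart (so $\mathcal{H}_M=M^{\perp_{\neq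 0}}$, respectively ${}^{\perp_{\neq 0}}M$) and $H^0_M=\tau^{\ge 0}\tau^{\le 0}:\mathcal{T}\to\mathcal{H}_M$ the cohomological functor. For an object $M$ of a category $\mathcal{A}$ let $\mathsf{Add}_{\mathcal{A}}(M)$ (respectively $\mathsf{Prod}_{\mathcal{A}}(M)$) be the smallest strict full subcategory containing $M$ and closed under set-indexed coproducts (respectively products) and direct summands. (1) If $T$ is a silting object of $\mathcal{T}$, then $\mathsf{Add}_{\mathcal{H}_T}(H^0_T(T))=\mathsf{Proj}(\mathcal{H}_T)$, the full subcategory of projective objects of $\mathcal{H}_T$, and $H^0_T$ restricts to an equivalence $\mathsf{Add}_{\mathcal{T}}(T)\to\mathsf{Proj}(\mathcal{H}_T)$. (2) If $C$ is a cosilting object of $\mathcal{T}$, then $\mathsf{Prod}_{\mathcal{H}_C}(H^0_C(C))=\mathsf{Inj}(\mathcal{H}_C)$, the full subcategory of injective objects of $\mathcal{H}_C$, and $H^0_C$ restricts to an equivalence $\mathsf{Prod}_{\mathcal{T}}(C)\to\mathsf{Inj}(\mathcal{H}_C)$. -/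

import Mathlib

open CategoryTheory CategoryTheory.Limits CategoryTheory.Pretriangulated
open CategoryTheory.Triangulated

universe v u v' u'

namespace SiltingTheory

section Closures

variable {C : Type u} [Category.{v} C]

/-- `Add(M)`: the smallest strict full subcategory which contains `M` and is closed under
(set-indexed) coproducts and direct summands. In the additive categories considered here, in which
idempotents split, direct summands are the same thing as retracts. Closure under retracts includes
closure under isomorphisms. -/
inductive AddClosure (M : C) : C → Prop
  | self : AddClosure M M
  | coproduct {J : Type v} {X : J → C} (hX : ∀ j, AddClosure M (X j)) (c : Cofan X) (hc : IsColimit c) :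
      AddClosure M c.pt
  | summand {X Y : C} (hY : AddClosure M Y) (r : Retract X Y) : AddClosure M X

/-- `Prod(M)`: the smallest strict full subcategory which contains `M` and is closed under
(set-indexed) products and direct summands. -/
inductive ProdClosure (M : C) : C → Prop
  | self : ProdClosure M M
  | product {J : Type v} {X : J → C} (hX : ∀ j, ProdClosure M (X j)) (c : Fan X) (hc : IsLimit c) :
      ProdClosure M c.pt
  | summand {X Y : C} (hY : ProdClosure M Y) (r : Retract X Y) : ProdClosure M X

/-- The full subcategory of projective objects. -/
def Proj (C : Type u) [Category.{v} C] : ObjectProperty C := fun X => Projective X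

/-- The full subcategory of injective objects. -/
def Inj (C : Type u) [Category.{v} C] : ObjectProperty C := fun X => Injective X

/-- The functor `F` restricts to an equivalence between the full subcategories `P` and `Q`:
it sends objects of `P` to objects of `Q`, and the restricted functor is an equivalence. -/
def RestrictsToEquivalence {D : Type u'} [Category.{v'} D] (F : C ⥤ D)
    (P : ObjectProperty C) (Q : ObjectProperty D) : Prop :=
  ∃ h : ∀ X : P.FullSubcategory, Q (F.obj X.obj), (Q.lift (P.ι ⋙ F) h).IsEquivalence

end Closures

section Compact

variable {C : Type u} [Category.{v} C] [Preadditive C]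

/-- `X` is compact: `Hom(X, -)`, with values in abelian groups, commutes with coproducts. -/
def IsCompactObj : ObjectProperty C := fun X =>
  ∀ J : Type v, PreservesColimitsOfShape (Discrete J) (preadditiveCoyoneda.obj (Opposite.op X))

/-- A category with coproducts is compactly generated: there is only a set of isomorphism classes
of compact objects, and an object that receives no nonzero morphism from a compact object is
zero. -/
class IsCompactlyGenerated (C : Type u) [Category.{v} C] [Preadditive C] : Prop where
  hasCoproducts : HasCoproducts.{v} C
  essentiallySmall : ObjectProperty.EssentiallySmall.{v} (IsCompactObj (C := C))
  isZero_of_hom_eq_zero (Y : C)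
    (h : ∀ X : C, IsCompactObj X → ∀ f : X ⟶ Y, f = 0) : IsZero Y

end Compact

section Silting

variable {C : Type u} [Category.{v} C] [Preadditive C] [HasShift C ℤ]

/-- `M^{⊥_I}`: the objects `Y` with `Hom(M, Y[i]) = 0` for all `i ∈ I`. -/
def rightPerp (M : C) (I : Set ℤ) : ObjectProperty C :=
  fun Y => ∀ i ∈ I, ∀ f : M ⟶ Y⟦i⟧, f = 0

/-- `^{⊥_I}M`: the objects `Y` with `Hom(Y, M[i]) = 0` for all `i ∈ I`. -/
def leftPerp (M : C) (I : Set ℤ) : ObjectProperty C :=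
  fun Y => ∀ i ∈ I, ∀ f : Y ⟶ M⟦i⟧, f = 0

variable [HasZeroObject C] [∀ n : ℤ, (shiftFunctor C n).Additive] [Pretriangulated C]

/-- `M` is silting: `(M^{⊥_{>0}}, M^{⊥_{≤0}})` is a t-structure, and `M` lies in `M^{⊥_{>0}}`.
In cohomological indexing, the aisle is the class of objects of degree `≤ 0` and
the coaisle the class of objects of degree `≥ 1`. -/
def IsSilting (M : C) : Prop :=
  (∃ t : TStructure C, t.le 0 = rightPerp M (Set.Ioi 0) ∧ t.ge 1 = rightPerp M (Set.Iic 0)) ∧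
    rightPerp M (Set.Ioi 0) M

/-- `M` is cosilting: `(^{⊥_{≤0}}M, ^{⊥_{>0}}M)` is a t-structure, and `M` lies in `^{⊥_{>0}}M`.
In cohomological indexing, the aisle is the class of objects of degree `≤ -1` and
the coaisle the class of objects of degree `≥ 0`. -/
def IsCosilting (M : C) : Prop :=
  (∃ t : TStructure C, t.le (-1) = leftPerp M (Set.Iic 0) ∧ t.ge 0 = leftPerp M (Set.Ioi 0)) ∧
    leftPerp M (Set.Ioi 0) M

/-- The t-structure of a silting object `T`, with heart
`T^{⊥_{>0}} ∩ T^{⊥_{<0}}`. It is uniquely determined by its aisle and coaisle. -/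
noncomputable def IsSilting.tStructure {T : C} (h : IsSilting T) : TStructure C :=
  h.1.choose

/-- The t-structure of a cosilting object `M`, with heart
`^{⊥_{>0}}M ∩ ^{⊥_{<0}}M`. It is uniquely determined by its aisle and coaisle. -/
noncomputable def IsCosilting.tStructure {M : C} (h : IsCosilting M) : TStructure C :=
  h.1.choose

end Silting

section Heart

variable {C : Type u} [Category.{v} C] [Preadditive C] [HasZeroObject C] [HasShift C ℤ]
  [∀ n : ℤ, (shiftFunctor C n).Additive] [Pretriangulated C] [IsTriangulated C]

/-- The heart of a t-structure, as a category. -/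
abbrev HeartCat (t : TStructure C) : Type u := t.heart.FullSubcategory

/-- The cohomological functor `H⁰ = τ^{≥0} τ^{≤0}` of a t-structure, with values in the heart. -/
noncomputable def H0 (t : TStructure C) : C ⥤ HeartCat t :=
  t.heart.lift (t.truncGELE 0 0) fun _ =>
    (t.mem_heart_iff _).2 ⟨inferInstance, inferInstance⟩

end Heart

end SiltingTheory

/-!
The two halves of the theorem are dual, and the argument for a silting object `T` with t-structure
`t` is the following. The object `T`, and with it every object of `Add(T)`, lies in
`aisleProjective t`: it has degree `≤ 0` and admits no nonzero morphism to an object of degree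
`≤ -1`. For `X` in this class and `Y` of degree `≤ 0`, the truncation triangle
`τ^{≤-1} Y ⟶ Y ⟶ H⁰ Y` gives `Hom(X, Y) ≅ Hom(X, H⁰ Y) ≅ Hom(H⁰ X, H⁰ Y)`, so `H⁰` is fully faithful
on the class (`H0_map_injective`, `H0_map_surjective`), and `H⁰ X` is projective in the heart
because the cone of an epimorphism of the heart has degree `≤ -1` (`projective_H0_obj`). Conversely, for `P`
in the heart the cone of the evaluation `∐_{T ⟶ P} T ⟶ P` has degree `≤ -1`
(`IsSilting.exists_cover`), so that `H⁰` of this coproduct maps onto `P`. If `P` is projective, it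
is therefore a direct summand of `H⁰(∐ T)`; as `H⁰` preserves coproducts of objects of the aisle,
`P` is in `Add(H⁰ T)`. The corresponding idempotent lifts to `∐ T`, where it splits, and this gives an
object of `Add(T)` which `H⁰` sends to `P`.

Two facts on triangulated categories are needed. Idempotents split in the presence of countable
coproducts (`isIdempotentComplete_of_hasCoproductsOfShape_nat`), the image of `e` being the homotopy
colimit of its iterates. The cosilting half uses products of copies of a cosilting object, and a
compactly generated triangulated category has products (`IsCompactlyGenerated.hasProducts`). The
latter is the case of Brown representability for the functors `∏ⱼ Hom(-, A j)`: starting from any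
object with a family of morphisms to the `A j`, coproducts of compact objects are attached so that
the homotopy colimit `X` satisfies `Hom(G, X) ≅ ∏ⱼ Hom(G, A j)` for the compact generators `G`
(`exists_isUniversalOn`), and any compatible morphism between two such objects is an isomorphism
(`IsUniversalOn.isIso`). The freedom in the starting object then yields the universal property on
all objects.
-/

namespace SiltingTheory


/-! ### Exactness of `Hom` on distinguished triangles -/

section Triangles

variable {C : Type u} [Category.{v} C] [Preadditive C] [HasZeroObject C] [HasShift C ℤ]
  [∀ n : ℤ, (shiftFunctor C n).Additive] [Pretriangulated C]
  {X Y Z : C} {f : X ⟶ Y} {g : Y ⟶ Z} {h : Z ⟶ X⟦(1 : ℤ)⟧}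

lemma exists_desc_obj₃ (hT : Triangle.mk f g h ∈ distTriang C) {W : C} (k : Y ⟶ W)
    (hk : f ≫ k = 0) : ∃ l : Z ⟶ W, g ≫ l = k :=
  (Triangle.yoneda_exact₂ _ hT k hk).imp fun _ => Eq.symm

lemma exists_lift_obj₁ (hT : Triangle.mk f g h ∈ distTriang C) {W : C} (k : W ⟶ Y)
    (hk : k ≫ g = 0) : ∃ l : W ⟶ X, l ≫ f = k :=
  (Triangle.coyoneda_exact₂ _ hT k hk).imp fun _ => Eq.symm

lemma exists_desc_shift_obj₁ (hT : Triangle.mk f g h ∈ distTriang C) {W : C} (k : Z ⟶ W)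
    (hk : g ≫ k = 0) : ∃ l : X⟦(1 : ℤ)⟧ ⟶ W, h ≫ l = k :=
  (Triangle.yoneda_exact₃ _ hT k hk).imp fun _ => Eq.symm

lemma exists_lift_obj₂ (hT : Triangle.mk f g h ∈ distTriang C) {W : C} (k : W ⟶ Z)
    (hk : k ≫ h = 0) : ∃ l : W ⟶ Y, l ≫ g = k :=
  (Triangle.coyoneda_exact₃ _ hT k hk).imp fun _ => Eq.symm

lemma exists_shift_map_eq_comp (hT : Triangle.mk f g h ∈ distTriang C) {W : C} (k : W ⟶ X)
    (hk : k ≫ f = 0) : ∃ l : W⟦(1 : ℤ)⟧ ⟶ Z, l ≫ h = k⟦(1 : ℤ)⟧' :=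
  (Triangle.coyoneda_exact₁ _ hT (k⟦(1 : ℤ)⟧') ((Functor.map_comp _ _ _).symm.trans
    ((congrArg _ hk).trans (Functor.map_zero _ _ _)))).imp fun _ => Eq.symm

end Triangles

/-! ### Telescopes and idempotents -/

section Telescope

variable {C : Type u} [Category.{v} C] [Preadditive C] [HasCoproductsOfShape ℕ C]

/-- For a sequence `X 0 ⟶ X 1 ⟶ ⋯`, the endomorphism `1 - shift` of `∐ X`. Its cone is the
homotopy colimit of the sequence. -/
noncomputable def telescopeMap {X : ℕ → C} (u : ∀ n, X n ⟶ X (n + 1)) : ∐ X ⟶ ∐ X :=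
  Sigma.desc fun n => Sigma.ι X n - u n ≫ Sigma.ι X (n + 1)

lemma ι_telescopeMap {X : ℕ → C} (u : ∀ n, X n ⟶ X (n + 1)) (n : ℕ) :
    Sigma.ι X n ≫ telescopeMap u = Sigma.ι X n - u n ≫ Sigma.ι X (n + 1) := by
  simp [telescopeMap]

lemma ι_telescopeMap_assoc {X : ℕ → C} (u : ∀ n, X n ⟶ X (n + 1)) (n : ℕ) {Z : C}
    (f : ∐ X ⟶ Z) :
    Sigma.ι X n ≫ telescopeMap u ≫ f = (Sigma.ι X n - u n ≫ Sigma.ι X (n + 1)) ≫ f := by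
  rw [← ι_telescopeMap, Category.assoc]

lemma telescopeMap_comp_eq_zero_iff {X : ℕ → C} (u : ∀ n, X n ⟶ X (n + 1)) {Z : C}
    (f : ∐ X ⟶ Z) :
    telescopeMap u ≫ f = 0 ↔ ∀ n, u n ≫ Sigma.ι X (n + 1) ≫ f = Sigma.ι X n ≫ f := by
  constructor
  · intro h n
    have := Sigma.ι X n ≫= h
    rw [ι_telescopeMap_assoc, Preadditive.sub_comp, comp_zero, sub_eq_zero, Category.assoc] at this
    exact this.symm
  · intro h
    refine Sigma.hom_ext _ _ fun n => ?_
    rw [ι_telescopeMap_assoc, Preadditive.sub_comp, Category.assoc, h n, sub_self, comp_zero]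

end Telescope

section Idempotents

variable {C : Type u} [Category.{v} C] [Preadditive C] [HasZeroObject C] [HasShift C ℤ]
  [∀ n : ℤ, (shiftFunctor C n).Additive] [Pretriangulated C] [HasCoproductsOfShape ℕ C]

/-- An idempotent `e` is split by the homotopy colimit of the sequence `X ⟶ X ⟶ ⋯` with all
transition maps equal to `e`. -/
lemma isIdempotentComplete_of_hasCoproductsOfShape_nat : IsIdempotentComplete C where
  idempotents_split X e he := by
    obtain ⟨Y, p, δ, hT⟩ := distinguished_cocone_triangle
      (telescopeMap (X := fun _ : ℕ => X) fun _ => e)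
    -- The `n`-th component of the retraction is `-e (ι 0 + ⋯ + ι (n - 1))`, plus `(1 - e) ι n` on
    -- the complementary summand, where the telescope map is the identity.
    let r : (∐ fun _ : ℕ => X) ⟶ ∐ fun _ : ℕ => X := Sigma.desc fun n =>
      (𝟙 X - e) ≫ Sigma.ι (fun _ : ℕ => X) n -
        e ≫ ∑ i ∈ Finset.range n, Sigma.ι (fun _ : ℕ => X) i
    have hr : telescopeMap (X := fun _ : ℕ => X) (fun _ => e) ≫ r = 𝟙 _ := by
      refine Sigma.hom_ext _ _ fun n => ?_
      simp only [r, ι_telescopeMap_assoc, Preadditive.sub_comp, Category.assoc, colimit.ι_desc,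
        Cofan.mk_ι_app, Category.comp_id, Finset.sum_range_succ, Preadditive.comp_add,
        Preadditive.comp_sub, Category.id_comp, reassoc_of% he]
      abel
    have : Mono (telescopeMap (X := fun _ : ℕ => X) fun _ => e) :=
      (SplitMono.mk r hr).mono
    have : Epi p := Triangle.epi₂ _ hT (Triangle.mor₃_eq_zero_of_mono₁ _ hT this)
    have hp : telescopeMap (X := fun _ : ℕ => X) (fun _ => e) ≫ p = 0 :=
      comp_distTriang_mor_zero₁₂ _ hT
    have hpn := (telescopeMap_comp_eq_zero_iff _ p).1 hp
    have hq : telescopeMap (X := fun _ : ℕ => X) (fun _ => e) ≫ Sigma.desc (fun _ => e) = 0 := by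
      rw [telescopeMap_comp_eq_zero_iff]
      simp [he]
    obtain ⟨i, hi⟩ := exists_desc_obj₃ hT _ hq
    have he0 : ∀ n, Sigma.ι (fun _ : ℕ => X) n ≫ p = e ≫ Sigma.ι (fun _ : ℕ => X) 0 ≫ p := by
      have h1 : ∀ n, e ≫ Sigma.ι (fun _ : ℕ => X) n ≫ p = Sigma.ι (fun _ : ℕ => X) n ≫ p := by
        intro n
        rw [← hpn n, reassoc_of% he]
      intro n
      induction n with
      | zero => exact (h1 0).symm
      | succ n ih => rw [← ih, ← hpn n, h1 (n + 1)]
    refine ⟨Y, i, Sigma.ι (fun _ : ℕ => X) 0 ≫ p, ?_, ?_⟩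
    · rw [← cancel_epi p, reassoc_of% hi]
      refine Sigma.hom_ext _ _ fun n => ?_
      simp [he0 n]
    · rw [Category.assoc, hi]
      simp

end Idempotents


/-! ### Products in compactly generated triangulated categories -/

section CountablyCompact

variable {C : Type u} [Category.{v} C] [Preadditive C] [HasCoproductsOfShape ℕ C]

/-- Every morphism from `G` to a countable coproduct is a finite sum of morphisms which factor
through the summands. -/
def IsCountablyCompact (G : C) : Prop :=
  ∀ (X : ℕ → C) (f : G ⟶ ∐ X), ∃ (N : ℕ) (g : ∀ n, G ⟶ X n),
    f = ∑ n ∈ Finset.range N, g n ≫ Sigma.ι X n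

lemma IsCountablyCompact.of_iso {G G' : C} (hG : IsCountablyCompact G) (e : G ≅ G') :
    IsCountablyCompact G' := fun X f => by
  obtain ⟨N, g, hg⟩ := hG X (e.hom ≫ f)
  refine ⟨N, fun n => e.inv ≫ g n, ?_⟩
  rw [← cancel_epi e.hom, hg]
  simp [Preadditive.comp_sum]

lemma IsCountablyCompact.exists_hom_of_isColimit {G : C} (hG : IsCountablyCompact G) {X : ℕ → C}
    {c : Cofan X} (hc : IsColimit c) (f : G ⟶ c.pt) :
    ∃ (N : ℕ) (g : ∀ n, G ⟶ X n), f = ∑ n ∈ Finset.range N, g n ≫ c.inj n := by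
  let e : ∐ X ≅ c.pt := (coproductIsCoproduct X).coconePointUniqueUpToIso hc
  obtain ⟨N, g, hg⟩ := hG X (f ≫ e.inv)
  refine ⟨N, g, ?_⟩
  rw [← cancel_mono e.inv, hg, Preadditive.sum_comp]
  refine Finset.sum_congr rfl fun n _ => ?_
  rw [Category.assoc]
  congr 1
  exact (IsColimit.comp_coconePointUniqueUpToIso_inv (coproductIsCoproduct X) hc ⟨n⟩).symm

lemma IsCountablyCompact.shift [HasShift C ℤ] [∀ n : ℤ, (shiftFunctor C n).Additive] {G : C}
    (hG : IsCountablyCompact G) (a : ℤ) : IsCountablyCompact (G⟦a⟧) := fun X f => by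
  have e : G⟦a⟧⟦-a⟧ ≅ G := (shiftEquiv C a).unitIso.symm.app G
  obtain ⟨N, g, hg⟩ := (hG.of_iso e.symm).exists_hom_of_isColimit
    (isColimitCofanMkObjOfIsColimit (shiftFunctor C (-a)) _ _ (coproductIsCoproduct X))
    (f⟦-a⟧')
  refine ⟨N, fun n => (shiftFunctor C (-a)).preimage (g n), ?_⟩
  apply (shiftFunctor C (-a)).map_injective
  rw [hg, Functor.map_sum]
  simp

/-- If `Hom(G, -)` preserves a coproduct, then the subgroup of the finite sums of morphisms which
factor through the summands is everything, because the quotient by it receives the same maps as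
`0`. -/
lemma IsCompactObj.isCountablyCompact {G : C} (hG : IsCompactObj G) : IsCountablyCompact G := by
  intro X f
  let F := preadditiveCoyoneda.obj (Opposite.op G)
  have : PreservesColimitsOfShape (Discrete (ULift.{v} ℕ)) F := hG (ULift.{v} ℕ)
  have : PreservesColimitsOfShape (Discrete ℕ) F :=
    preservesColimitsOfShape_of_equiv (Discrete.equivalence Equiv.ulift) F
  have hc := isColimitCofanMkObjOfIsColimit F _ _ (coproductIsCoproduct X)
  let S : AddSubgroup (G ⟶ ∐ X) :=
    { carrier := {f | ∃ (N : ℕ) (g : ∀ n, G ⟶ X n), f = ∑ n ∈ Finset.range N, g n ≫ Sigma.ι X n}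
      zero_mem' := ⟨0, fun _ => 0, by simp⟩
      neg_mem' := by
        rintro _ ⟨N, g, rfl⟩
        exact ⟨N, fun n => - g n, by simp⟩
      add_mem' := by
        classical
        rintro _ _ ⟨N, g, rfl⟩ ⟨N', g', rfl⟩
        refine ⟨max N N', fun n => (if n < N then g n else 0) + (if n < N' then g' n else 0), ?_⟩
        simp only [Preadditive.add_comp, Finset.sum_add_distrib]
        congr 1
        · rw [← Finset.sum_subset (Finset.range_mono (le_max_left N N'))]
          · exact Finset.sum_congr rfl fun n hn => by simp [Finset.mem_range.1 hn]
          · intro n _ hn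
            simp [Finset.mem_range.not.1 hn]
        · rw [← Finset.sum_subset (Finset.range_mono (le_max_right N N'))]
          · exact Finset.sum_congr rfl fun n hn => by simp [Finset.mem_range.1 hn]
          · intro n _ hn
            simp [Finset.mem_range.not.1 hn] }
  have key : AddCommGrpCat.ofHom (QuotientAddGroup.mk' S) =
      (0 : F.obj (∐ X) ⟶ AddCommGrpCat.of ((G ⟶ ∐ X) ⧸ S)) := by
    refine Cofan.IsColimit.hom_ext hc _ _ fun n => ?_
    ext g
    refine (QuotientAddGroup.eq_zero_iff _).2 ⟨n + 1, fun m => if h : n = m then h ▸ g else 0, ?_⟩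
    rw [Finset.sum_eq_single n]
    · simp
      rfl
    · intro m _ hm
      simp [hm.symm]
    · simp
  exact (QuotientAddGroup.eq_zero_iff f).1 (ConcreteCategory.congr_hom key f)

/-- Composing with the projections onto the summands shows that the components `g n` of a morphism
annihilated by `1 - shift` satisfy `g 0 = 0` and `g (n + 1) = g n ≫ u n`. -/
lemma eq_zero_of_comp_telescopeMap_eq_zero {G : C} (hG : IsCountablyCompact G)
    {X : ℕ → C} (u : ∀ n, X n ⟶ X (n + 1)) (f : G ⟶ ∐ X) (hf : f ≫ telescopeMap u = 0) :
    f = 0 := by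
  classical
  let π (n : ℕ) : ∐ X ⟶ X n := Sigma.desc fun m => if h : m = n then eqToHom (by rw [h]) else 0
  have hπ (n : ℕ) : Sigma.ι X n ≫ π n = 𝟙 _ := by simp [π]
  have hπ' (m n : ℕ) (h : m ≠ n) : Sigma.ι X m ≫ π n = 0 := by simp [π, h]
  have h0 : telescopeMap u ≫ π 0 = π 0 := by
    refine Sigma.hom_ext _ _ fun n => ?_
    rw [ι_telescopeMap_assoc, Preadditive.sub_comp, Category.assoc, hπ' (n + 1) 0 (by simp),
      comp_zero, sub_zero]
  have hs (n : ℕ) : telescopeMap u ≫ π (n + 1) = π (n + 1) - π n ≫ u n := by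
    refine Sigma.hom_ext _ _ fun m => ?_
    rw [ι_telescopeMap_assoc, Preadditive.sub_comp, Preadditive.comp_sub, Category.assoc]
    congr 1
    by_cases h : m = n
    · subst h
      rw [hπ, reassoc_of% hπ]
      simp
    · rw [hπ' _ _ (by simpa using h), reassoc_of% (hπ' _ _ h)]
      simp
  have hz (n : ℕ) : f ≫ π n = 0 := by
    induction n with
    | zero => rw [← h0, reassoc_of% hf, zero_comp]
    | succ n ih =>
      have := f ≫= hs n
      rw [reassoc_of% hf, zero_comp, Preadditive.comp_sub, reassoc_of% ih, zero_comp,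
        sub_zero] at this
      exact this.symm
  obtain ⟨N, g, rfl⟩ := hG X f
  refine Finset.sum_eq_zero fun n hn => ?_
  have := hz n
  rw [Preadditive.sum_comp, Finset.sum_eq_single n] at this
  · rw [Category.assoc, hπ, Category.comp_id] at this
    rw [this, zero_comp]
  · intro m _ hm
    rw [Category.assoc, hπ' _ _ hm, comp_zero]
  · exact fun h => (h hn).elim

/-- A morphism from a countably compact object to the homotopy colimit that lifts to `∐ X` lifts to
some `X N`. -/
lemma exists_factor_of_telescopeMap_comp_eq_zero {G : C} (hG : IsCountablyCompact G)
    {X : ℕ → C} {u : ∀ n, X n ⟶ X (n + 1)} {Z : C} {p : ∐ X ⟶ Z}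
    (hp : telescopeMap u ≫ p = 0) (f : G ⟶ ∐ X) :
    ∃ (N : ℕ) (g : G ⟶ X N), g ≫ Sigma.ι X N ≫ p = f ≫ p := by
  obtain ⟨N, g, rfl⟩ := hG X f
  refine ⟨N, ?_⟩
  induction N with
  | zero => exact ⟨0, by simp⟩
  | succ N ih =>
    obtain ⟨k, hk⟩ := ih
    refine ⟨(k + g N) ≫ u N, ?_⟩
    rw [Category.assoc, (telescopeMap_comp_eq_zero_iff _ p).1 hp, Finset.sum_range_succ,
      Preadditive.add_comp, Preadditive.add_comp, hk, Category.assoc]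

end CountablyCompact

section Products

variable {C : Type u} [Category.{v} C] [Preadditive C] [HasZeroObject C] [HasShift C ℤ]
  [∀ n : ℤ, (shiftFunctor C n).Additive] [Pretriangulated C] [HasCoproducts.{v} C]
  [HasCoproductsOfShape ℕ C] {ι J : Type v} {G : ι → C} {A : J → C}

/-- A family `x` of morphisms `X ⟶ A j` is universal on the objects `G i` if every family of
morphisms `G i ⟶ A j` is induced by a unique morphism `G i ⟶ X`. -/
structure IsUniversalOn (G : ι → C) {X : C} (x : ∀ j, X ⟶ A j) : Prop where
  eq_zero (i : ι) (f : G i ⟶ X) (hf : ∀ j, f ≫ x j = 0) : f = 0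
  exists_hom (i : ι) (z : ∀ j, G i ⟶ A j) : ∃ f : G i ⟶ X, ∀ j, f ≫ x j = z j

omit [HasCoproductsOfShape ℕ C] in
lemma exists_hom_kill (G : ι → C) {X : C} (x : ∀ j, X ⟶ A j) :
    ∃ (X' : C) (x' : ∀ j, X' ⟶ A j) (w : X ⟶ X'), (∀ j, w ≫ x' j = x j) ∧
      ∀ i (f : G i ⟶ X), (∀ j, f ≫ x j = 0) → f ≫ w = 0 := by
  let K := Σ i, { f : G i ⟶ X // ∀ j, f ≫ x j = 0 }
  obtain ⟨X', w, δ, hT⟩ := distinguished_cocone_triangle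
    (Sigma.desc fun k : K => k.2.1)
  have hx (j : J) : ∃ l : X' ⟶ A j, w ≫ l = x j :=
    exists_desc_obj₃ hT (x j) (Sigma.hom_ext _ _ fun k => by simpa using k.2.2 j)
  choose x' hx' using hx
  refine ⟨X', x', w, hx', fun i f hf => ?_⟩
  have hw : (Sigma.desc fun k : K => k.2.1) ≫ w = 0 := comp_distTriang_mor_zero₁₂ _ hT
  simpa using Sigma.ι (fun k : K => G k.1) ⟨i, f, hf⟩ ≫= hw

/-- Brown's construction: starting from `Y` together with enough copies of the `G i` for
surjectivity, the kernels of `Hom(G i, X) → ∏ Hom(G i, A j)` are killed successively, and they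
vanish in the homotopy colimit because the `G i` are compact. -/
lemma exists_isUniversalOn (hG : ∀ i, IsCountablyCompact (G i))
    (hs : ∀ i, ∃ j, Nonempty ((G j)⟦(1 : ℤ)⟧ ≅ G i)) {Y : C} (y : ∀ j, Y ⟶ A j) :
    ∃ (X : C) (x : ∀ j, X ⟶ A j) (w : Y ⟶ X), (∀ j, w ≫ x j = y j) ∧ IsUniversalOn G x := by
  let K := Σ i, ∀ j, G i ⟶ A j
  let P := Σ X : C, ∀ j, X ⟶ A j
  choose next₁ next₂ w hw hw' using fun p : P => exists_hom_kill G p.2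
  let X₀ : P := ⟨Y ⊞ ∐ fun k : K => G k.1,
    fun j => biprod.desc (y j) (Sigma.desc fun k => k.2 j)⟩
  let S : ℕ → P := fun n => Nat.rec X₀ (fun _ p => ⟨next₁ p, next₂ p⟩) n
  let X : ℕ → C := fun n => (S n).1
  let u : ∀ n, X n ⟶ X (n + 1) := fun n => w (S n)
  have hu (n : ℕ) (j : J) : u n ≫ (S (n + 1)).2 j = (S n).2 j := hw (S n) j
  obtain ⟨Z, p, δ, hT⟩ := distinguished_cocone_triangle (telescopeMap u)
  have hp : telescopeMap u ≫ p = 0 := comp_distTriang_mor_zero₁₂ _ hT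
  have hd (n : ℕ) (j : J) : Sigma.ι X n ≫ Sigma.desc (f := X) (fun n => (S n).2 j) = (S n).2 j :=
    colimit.ι_desc _ _
  have hz (j : J) : ∃ l : Z ⟶ A j, p ≫ l = Sigma.desc (f := X) fun n => (S n).2 j :=
    exists_desc_obj₃ hT _ ((telescopeMap_comp_eq_zero_iff _ _).2 fun n => by rw [hd, hd, hu])
  choose z hz using hz
  have hz' (n : ℕ) (j : J) : Sigma.ι X n ≫ p ≫ z j = (S n).2 j := by
    rw [hz, hd]
  refine ⟨Z, z, biprod.inl ≫ Sigma.ι X 0 ≫ p, fun j => ?_, fun i f hf => ?_, fun i t => ?_⟩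
  · rw [Category.assoc, Category.assoc, hz']
    simp [S, X₀]
  · have hfδ : f ≫ δ = 0 := by
      obtain ⟨j, ⟨e⟩⟩ := hs i
      obtain ⟨k, hk⟩ := (shiftFunctor C (1 : ℤ)).map_surjective (e.hom ≫ f ≫ δ)
      have hδ : δ ≫ (telescopeMap u)⟦(1 : ℤ)⟧' = 0 := comp_distTriang_mor_zero₃₁ _ hT
      have : k = 0 := by
        refine eq_zero_of_comp_telescopeMap_eq_zero (hG j) u k ?_
        apply (shiftFunctor C (1 : ℤ)).map_injective
        rw [Functor.map_comp, hk, Category.assoc, Category.assoc, hδ, comp_zero, comp_zero,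
          Functor.map_zero]
      rw [← cancel_epi e.hom, ← hk, this, Functor.map_zero, comp_zero]
    obtain ⟨g, hg⟩ := exists_lift_obj₂ hT f hfδ
    obtain ⟨N, k, hk⟩ := exists_factor_of_telescopeMap_comp_eq_zero (hG i) hp g
    rw [hg] at hk
    have hku : k ≫ u N = 0 := hw' (S N) i k fun j => by
      rw [← hf j, ← hk, Category.assoc, Category.assoc, hz']
    rw [← hk, ← (telescopeMap_comp_eq_zero_iff _ p).1 hp, reassoc_of% hku, zero_comp]
  · refine ⟨Sigma.ι (fun k : K => G k.1) ⟨i, t⟩ ≫ biprod.inr ≫ Sigma.ι X 0 ≫ p, fun j => ?_⟩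
    rw [Category.assoc, Category.assoc, Category.assoc, hz']
    simp [S, X₀]

omit [HasCoproducts.{v} C] [HasCoproductsOfShape ℕ C] in
lemma IsUniversalOn.isIso (hs : ∀ i, ∃ j, Nonempty ((G j)⟦(1 : ℤ)⟧ ≅ G i))
    (hgen : ∀ Y : C, (∀ i (f : G i ⟶ Y), f = 0) → IsZero Y) {X X' : C} {x : ∀ j, X ⟶ A j}
    {x' : ∀ j, X' ⟶ A j} (hx : IsUniversalOn G x) (hx' : IsUniversalOn G x') (w : X ⟶ X')
    (hw : ∀ j, w ≫ x' j = x j) : IsIso w := by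
  obtain ⟨Z, p, δ, hT⟩ := distinguished_cocone_triangle w
  have hZ : IsZero Z := hgen Z fun i f => by
    have hfδ : f ≫ δ = 0 := by
      obtain ⟨j, ⟨e⟩⟩ := hs i
      obtain ⟨k, hk⟩ := (shiftFunctor C (1 : ℤ)).map_surjective (e.hom ≫ f ≫ δ)
      have hδ : δ ≫ w⟦(1 : ℤ)⟧' = 0 := comp_distTriang_mor_zero₃₁ _ hT
      have hkw : k ≫ w = 0 := by
        apply (shiftFunctor C (1 : ℤ)).map_injective
        rw [Functor.map_comp, hk, Category.assoc, Category.assoc, hδ, comp_zero, comp_zero,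
          Functor.map_zero]
      have : k = 0 := hx.eq_zero j k fun a => by rw [← hw, reassoc_of% hkw, zero_comp]
      rw [← cancel_epi e.hom, ← hk, this, Functor.map_zero, comp_zero]
    obtain ⟨g, hg⟩ := exists_lift_obj₂ hT f hfδ
    obtain ⟨k, hk⟩ := hx.exists_hom i fun j => g ≫ x' j
    have hkg : k ≫ w = g := by
      rw [← sub_eq_zero]
      refine hx'.eq_zero i _ fun j => ?_
      rw [Preadditive.sub_comp, Category.assoc, hw, hk, sub_self]
    have hwp : w ≫ p = 0 := comp_distTriang_mor_zero₁₂ _ hT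
    rw [← hg, ← hkg, Category.assoc, hwp, comp_zero]
  exact (Triangle.isZero₃_iff_isIso₁ _ hT).1 hZ

/-- A morphism `Y ⟶ X` (for existence), or the cone of one (for uniqueness), embeds compatibly
into an object which is again universal on the `G i`, and the latter is isomorphic to `X`. -/
lemma IsUniversalOn.nonempty_isLimit (hG : ∀ i, IsCountablyCompact (G i))
    (hs : ∀ i, ∃ j, Nonempty ((G j)⟦(1 : ℤ)⟧ ≅ G i))
    (hgen : ∀ Y : C, (∀ i (f : G i ⟶ Y), f = 0) → IsZero Y)
    {X : C} {x : ∀ j, X ⟶ A j} (hx : IsUniversalOn G x) : Nonempty (IsLimit (Fan.mk X x)) := by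
  have hex {Y : C} (y : ∀ j, Y ⟶ A j) : ∃ f : Y ⟶ X, ∀ j, f ≫ x j = y j := by
    obtain ⟨X', x', w, hw, hx'⟩ := exists_isUniversalOn hG hs
      (Y := Y ⊞ X) fun j => biprod.desc (y j) (x j)
    have hX (j : J) : (biprod.inr ≫ w) ≫ x' j = x j := by simp [hw]
    have := hx.isIso hs hgen hx' (biprod.inr ≫ w) hX
    refine ⟨biprod.inl ≫ w ≫ inv (biprod.inr ≫ w), fun j => ?_⟩
    have hinv : inv (biprod.inr ≫ w) ≫ x j = x' j := by rw [IsIso.inv_comp_eq, hX]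
    rw [Category.assoc, Category.assoc, hinv, hw, biprod.inl_desc]
  have huniq {Y : C} (f : Y ⟶ X) (hf : ∀ j, f ≫ x j = 0) : f = 0 := by
    obtain ⟨Z, p, δ, hT⟩ := distinguished_cocone_triangle f
    choose z hz using fun j => exists_desc_obj₃ hT (x j) (hf j)
    obtain ⟨X', x', w, hw, hx'⟩ := exists_isUniversalOn hG hs z
    have := hx.isIso hs hgen hx' (p ≫ w) fun j => by rw [Category.assoc, hw, hz]
    have hfp : f ≫ p = 0 := comp_distTriang_mor_zero₁₂ _ hT
    rw [← cancel_mono (p ≫ w), reassoc_of% hfp, zero_comp, zero_comp]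
  refine ⟨Fan.IsLimit.mk _ (fun c => (hex c.proj).choose) (fun c => (hex c.proj).choose_spec)
    fun c m hm => ?_⟩
  rw [← sub_eq_zero]
  refine huniq _ fun j => ?_
  rw [Preadditive.sub_comp, (hex c.proj).choose_spec, sub_eq_zero]
  exact hm j

end Products

section CompactlyGenerated

variable {C : Type u} [Category.{v} C] [Preadditive C]

lemma IsCompactlyGenerated.hasCoproductsOfShape_nat [IsCompactlyGenerated C] :
    HasCoproductsOfShape ℕ C :=
  have := IsCompactlyGenerated.hasCoproducts (C := C)
  hasColimitsOfShape_of_equivalence (Discrete.equivalence (Equiv.ulift.{v} (α := ℕ)))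

variable [HasZeroObject C] [HasShift C ℤ] [∀ n : ℤ, (shiftFunctor C n).Additive]
  [Pretriangulated C]

open ZeroObject in
/-- Representatives of the compact objects together with all their shifts form a small generating
family which is stable under shifts, so that no closure property of compact objects is needed. -/
theorem IsCompactlyGenerated.hasProducts [IsCompactlyGenerated C] : HasProducts.{v} C := by
  have := IsCompactlyGenerated.hasCoproducts (C := C)
  have := IsCompactlyGenerated.hasCoproductsOfShape_nat (C := C)
  have := IsCompactlyGenerated.essentiallySmall (C := C)
  obtain ⟨Q, _, hQ, hQ'⟩ :=
    ObjectProperty.EssentiallySmall.exists_small_le.{v} (IsCompactObj (C := C))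
  let G : Shrink.{v} (Subtype Q) × ULift.{v} ℤ → C :=
    fun i => (((equivShrink _).symm i.1).1)⟦i.2.down⟧
  have hG (i) : IsCountablyCompact (G i) :=
    (hQ _ ((equivShrink _).symm i.1).2).isCountablyCompact.shift _
  have hs (i) : ∃ j, Nonempty ((G j)⟦(1 : ℤ)⟧ ≅ G i) :=
    ⟨⟨i.1, ⟨i.2.down - 1⟩⟩, ⟨((shiftFunctorAdd' C (i.2.down - 1) 1 i.2.down (by simp)).app _).symm⟩⟩
  have hgen (Y : C) (hY : ∀ i (f : G i ⟶ Y), f = 0) : IsZero Y := by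
    refine IsCompactlyGenerated.isZero_of_hom_eq_zero Y fun X hX f => ?_
    obtain ⟨X', hX', ⟨e⟩⟩ := hQ' _ hX
    let e' : G ⟨equivShrink _ ⟨X', hX'⟩, ⟨0⟩⟩ ≅ X :=
      (shiftFunctorZero C ℤ).app _ ≪≫ eqToIso (by simp) ≪≫ e.symm
    rw [← cancel_epi e'.hom, comp_zero]
    exact hY _ _
  intro J
  have (A : J → C) : HasLimit (Discrete.functor A) := by
    obtain ⟨X, x, -, -, hx⟩ := exists_isUniversalOn (A := A) hG hs (Y := 0) fun _ => 0
    obtain ⟨h⟩ := hx.nonempty_isLimit hG hs hgen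
    exact ⟨_, h⟩
  exact ⟨fun K => hasLimit_of_iso Discrete.natIsoFunctor.symm⟩

end CompactlyGenerated


/-! ### Objects of the aisle with projective cohomology -/

section Aisle

variable {C : Type u} [Category.{v} C] [Preadditive C] [HasZeroObject C] [HasShift C ℤ]
  [∀ n : ℤ, (shiftFunctor C n).Additive] [Pretriangulated C]
  (t : TStructure C)

/-- The objects `X` of degree `≤ 0` such that `Hom(X, Y) = 0` for all `Y` of degree `≤ -1`. -/
def aisleProjective : ObjectProperty C :=
  fun X => t.IsLE X 0 ∧ ∀ ⦃Y : C⦄ (f : X ⟶ Y), t.IsLE Y (-1) → f = 0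

variable {t}

lemma aisleProjective_of_retract {X Y : C} (r : Retract X Y) (hY : aisleProjective t Y) :
    aisleProjective t X := by
  have := hY.1
  refine ⟨(t.isLE_iff_orthogonal 0 1 (by simp) X).2 fun Z f _ => ?_, fun Z f hZ => ?_⟩
  · rw [← Category.id_comp f, ← r.retract, Category.assoc, t.zero (r.r ≫ f) 0 1, comp_zero]
  · rw [← Category.id_comp f, ← r.retract, Category.assoc, hY.2 (r.r ≫ f) hZ, comp_zero]

lemma isLE_pt_of_isColimit {J : Type*} {X : J → C} (hX : ∀ j, t.IsLE (X j) 0) {c : Cofan X}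
    (hc : IsColimit c) : t.IsLE c.pt 0 :=
  (t.isLE_iff_orthogonal 0 1 (by simp) _).2 fun Z f _ =>
    Cofan.IsColimit.hom_ext hc _ _ fun j => by
      have := hX j
      rw [comp_zero]
      exact t.zero _ 0 1

lemma aisleProjective_of_isColimit {J : Type*} {X : J → C} (hX : ∀ j, aisleProjective t (X j))
    {c : Cofan X} (hc : IsColimit c) : aisleProjective t c.pt :=
  ⟨isLE_pt_of_isColimit (fun j => (hX j).1) hc, fun Z f hZ =>
    Cofan.IsColimit.hom_ext hc _ _ fun j => by
      rw [comp_zero]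
      exact (hX j).2 _ hZ⟩

lemma aisleProjective_of_addClosure {T : C} (hT : aisleProjective t T) {X : C}
    (hX : AddClosure T X) : aisleProjective t X := by
  induction hX with
  | self => exact hT
  | coproduct _ c hc ih => exact aisleProjective_of_isColimit ih hc
  | summand _ r ih => exact aisleProjective_of_retract r ih

variable (t)
variable [IsTriangulated C]

/-- An object of the aisle agrees with its truncation `τ^{≤0}`. -/
noncomputable def truncLEIso (X : C) [t.IsLE X 0] : (t.truncLE 0).obj X ≅ X :=
  asIso ((t.truncLEι 0).app X)

/-- The canonical morphism `X ⟶ τ^{≥0} τ^{≤0} X` for an object `X` of the aisle. -/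
noncomputable def toH0 (X : C) [t.IsLE X 0] : X ⟶ ((H0 t).obj X).obj :=
  (truncLEIso t X).inv ≫ (t.truncGEπ 0).app ((t.truncLE 0).obj X)

lemma toH0_naturality {X Y : C} [t.IsLE X 0] [t.IsLE Y 0] (f : X ⟶ Y) :
    toH0 t X ≫ ((H0 t).map f).hom = f ≫ toH0 t Y := by
  have h1 := (t.truncGEπ 0).naturality ((t.truncLE 0).map f)
  have h2 : (t.truncLE 0).map f ≫ (truncLEIso t Y).hom = (truncLEIso t X).hom ≫ f :=
    (t.truncLEι 0).naturality f
  have h3 : (truncLEIso t X).inv ≫ (t.truncLE 0).map f = f ≫ (truncLEIso t Y).inv := by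
    rw [Iso.inv_comp_eq, ← Category.assoc, ← h2, Category.assoc, Iso.hom_inv_id, Category.comp_id]
  refine (Category.assoc _ _ _).trans
    ((congrArg ((truncLEIso t X).inv ≫ ·) h1.symm).trans ?_)
  exact (reassoc_of% h3) ((t.truncGEπ 0).app ((t.truncLE 0).obj Y))

lemma toH0_naturality_assoc {X Y Z : C} [t.IsLE X 0] [t.IsLE Y 0] (f : X ⟶ Y)
    (g : ((H0 t).obj Y).obj ⟶ Z) :
    toH0 t X ≫ ((H0 t).map f).hom ≫ g = f ≫ toH0 t Y ≫ g := by
  rw [reassoc_of% toH0_naturality]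

/-- The truncation triangle `τ^{≤-1} X ⟶ X ⟶ H⁰ X` of an object `X` of the aisle. -/
lemma exists_distTriang_toH0 (X : C) [t.IsLE X 0] :
    ∃ (W : C) (_ : t.IsLE W (-1)) (a : W ⟶ X) (δ : ((H0 t).obj X).obj ⟶ W⟦(1 : ℤ)⟧),
      Triangle.mk a (toH0 t X) δ ∈ distTriang C := by
  have hT := t.triangleLEGE_distinguished (-1) 0 (by simp) ((t.truncLE 0).obj X)
  refine ⟨(t.truncLE (-1)).obj ((t.truncLE 0).obj X), inferInstance,
    (t.truncLEι (-1)).app ((t.truncLE 0).obj X) ≫ (truncLEIso t X).hom,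
    (t.truncGEδLE (-1) 0 (by simp)).app ((t.truncLE 0).obj X),
    isomorphic_distinguished _ hT _ ?_⟩
  refine Triangle.isoMk _ _ (Iso.refl _) (truncLEIso t X).symm (Iso.refl _) ?_ ?_ ?_
  · change ((t.truncLEι (-1)).app ((t.truncLE 0).obj X) ≫ (truncLEIso t X).hom) ≫
      (truncLEIso t X).inv = 𝟙 _ ≫ (t.truncLEι (-1)).app ((t.truncLE 0).obj X)
    rw [Category.id_comp]
    exact (Category.assoc _ _ _).trans
      ((congrArg _ (truncLEIso t X).hom_inv_id).trans (Category.comp_id _))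
  · exact Category.comp_id _
  · exact (congrArg _ (CategoryTheory.Functor.map_id _ _)).trans
      ((Category.comp_id _).trans (Category.id_comp _).symm)

variable {t}

lemma exists_toH0_comp_eq {X Z : C} [t.IsLE X 0] [t.IsGE Z 0] (f : X ⟶ Z) :
    ∃ g : ((H0 t).obj X).obj ⟶ Z, toH0 t X ≫ g = f := by
  obtain ⟨W, _, a, δ, hT⟩ := exists_distTriang_toH0 t X
  exact exists_desc_obj₃ hT f (t.zero _ (-1) 0)

lemma toH0_comp_injective {X Z : C} [t.IsLE X 0] [t.IsGE Z 0] {f g : ((H0 t).obj X).obj ⟶ Z}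
    (h : toH0 t X ≫ f = toH0 t X ≫ g) : f = g := by
  obtain ⟨W, _, a, δ, hT⟩ := exists_distTriang_toH0 t X
  have := t.isLE_shift W (-1) 1 (-2)
  obtain ⟨l, hl⟩ := exists_desc_shift_obj₁ hT (f - g)
    (by rw [Preadditive.comp_sub, h, sub_self])
  rw [← sub_eq_zero, ← hl, t.zero l (-2) 0, comp_zero]

instance isGE_obj_of_heart (Z : HeartCat t) : t.IsGE Z.obj 0 := ((t.mem_heart_iff _).1 Z.property).2

instance isLE_obj_of_heart (Z : HeartCat t) : t.IsLE Z.obj 0 := ((t.mem_heart_iff _).1 Z.property).1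

lemma comp_toH0_injective {X Y : C} (hX : aisleProjective t X) [t.IsLE Y 0] {f g : X ⟶ Y}
    (h : f ≫ toH0 t Y = g ≫ toH0 t Y) : f = g := by
  obtain ⟨W, hW, a, δ, hT⟩ := exists_distTriang_toH0 t Y
  obtain ⟨l, hl⟩ := exists_lift_obj₁ hT (f - g) (by rw [Preadditive.sub_comp, h, sub_self])
  rw [← sub_eq_zero, ← hl, hX.2 l hW, zero_comp]

lemma exists_comp_toH0_eq {X Y : C} (hX : aisleProjective t X) [t.IsLE Y 0]
    (f : X ⟶ ((H0 t).obj Y).obj) : ∃ g : X ⟶ Y, g ≫ toH0 t Y = f := by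
  obtain ⟨W, _, a, δ, hT⟩ := exists_distTriang_toH0 t Y
  have := t.isLE_shift W (-1) 1 (-2)
  exact exists_lift_obj₂ hT f (hX.2 _ (t.isLE_of_le _ (-2) (-1)))

lemma H0_map_injective {X Y : C} (hX : aisleProjective t X) (hY : aisleProjective t Y)
    {f g : X ⟶ Y} (h : (H0 t).map f = (H0 t).map g) : f = g := by
  have := hX.1
  have := hY.1
  apply comp_toH0_injective hX
  rw [← toH0_naturality, h, toH0_naturality]

lemma H0_map_surjective {X Y : C} (hX : aisleProjective t X) (hY : aisleProjective t Y)
    (φ : (H0 t).obj X ⟶ (H0 t).obj Y) : ∃ f : X ⟶ Y, (H0 t).map f = φ := by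
  have := hX.1
  have := hY.1
  obtain ⟨f, hf⟩ := exists_comp_toH0_eq hX (toH0 t X ≫ φ.hom)
  refine ⟨f, ObjectProperty.hom_ext _ (toH0_comp_injective ?_)⟩
  rw [toH0_naturality, hf]

/-- The cone of an epimorphism of the heart lies in degrees `≤ -1`. -/
lemma exists_lift_of_epi_heart {X : C} (hX : aisleProjective t X) {A B : HeartCat t}
    (π : A ⟶ B) [Epi π] (f : X ⟶ B.obj) : ∃ g : X ⟶ A.obj, g ≫ π.hom = f := by
  obtain ⟨W, p, δ, hT⟩ := distinguished_cocone_triangle π.hom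
  have := t.isLE_shift A.obj 0 1 (-1)
  have : t.IsLE W 0 := t.isLE₂ _ (rot_of_distTriang _ hT) 0 (isLE_obj_of_heart B)
    (t.isLE_of_le (A.obj⟦(1 : ℤ)⟧) (-1) 0)
  have hp : p ≫ (t.truncGEπ 0).app W = 0 := by
    let Q : HeartCat t :=
      ⟨(t.truncGE 0).obj W, (t.mem_heart_iff _).2 ⟨inferInstance, inferInstance⟩⟩
    let k : B ⟶ Q := ObjectProperty.homMk (p ≫ (t.truncGEπ 0).app W)
    have hk : k = 0 := by
      rw [← cancel_epi π, comp_zero]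
      have : π.hom ≫ p = 0 := comp_distTriang_mor_zero₁₂ _ hT
      apply ObjectProperty.hom_ext
      change π.hom ≫ p ≫ _ = 0
      rw [reassoc_of% this, zero_comp]
    exact congrArg (fun k => k.hom) hk
  obtain ⟨l, hl⟩ := exists_desc_shift_obj₁ hT _ hp
  have hW : t.IsLE W (-1) := by
    rw [t.isLE_iff_isZero_truncGE_obj (-1) 0 (by simp), IsZero.iff_id_eq_zero]
    apply t.from_truncGE_obj_ext
    rw [comp_zero, Category.comp_id, ← hl, t.zero l (-1) 0, comp_zero]
  exact exists_lift_obj₁ hT f (hX.2 _ hW)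

lemma projective_H0_obj {X : C} (hX : aisleProjective t X) : Projective ((H0 t).obj X) where
  factors {A B} f π _ := by
    have := hX.1
    obtain ⟨g, hg⟩ := exists_lift_of_epi_heart hX π (toH0 t X ≫ f.hom)
    obtain ⟨k, hk⟩ := exists_toH0_comp_eq (t := t) g
    refine ⟨ObjectProperty.homMk k, ObjectProperty.hom_ext _ (toH0_comp_injective ?_)⟩
    change toH0 t X ≫ k ≫ π.hom = _
    rw [reassoc_of% hk, hg]

/-- `H⁰` preserves coproducts of objects of the aisle, being a left adjoint there. -/
lemma nonempty_isColimit_H0 {J : Type*} {X : J → C} (hX : ∀ j, t.IsLE (X j) 0) {c : Cofan X}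
    (hc : IsColimit c) : Nonempty (IsColimit (Cofan.mk ((H0 t).obj c.pt)
      fun j => (H0 t).map (c.inj j) : Cofan fun j => (H0 t).obj (X j))) := by
  have := isLE_pt_of_isColimit hX hc
  have hex (s : Cofan fun j => (H0 t).obj (X j)) : ∃ g : (H0 t).obj c.pt ⟶ s.pt,
      ∀ j, (H0 t).map (c.inj j) ≫ g = s.inj j := by
    obtain ⟨g, hg⟩ := exists_toH0_comp_eq (t := t)
      (Cofan.IsColimit.desc hc fun j => toH0 t (X j) ≫ (s.inj j).hom)
    refine ⟨ObjectProperty.homMk g, fun j =>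
      ObjectProperty.hom_ext _ (toH0_comp_injective (X := X j) ?_)⟩
    change toH0 t (X j) ≫ ((H0 t).map (c.inj j)).hom ≫ g = _
    rw [toH0_naturality_assoc, hg, Cofan.IsColimit.fac]
  refine ⟨Cofan.IsColimit.mk _ (fun s => (hex s).choose) (fun s => (hex s).choose_spec)
    fun s m hm => ObjectProperty.hom_ext _ (toH0_comp_injective (X := c.pt)
      (Cofan.IsColimit.hom_ext hc _ _ fun j => ?_))⟩
  have := congrArg (fun k => k.hom) ((hm j).trans ((hex s).choose_spec j).symm)
  change ((H0 t).map (c.inj j)).hom ≫ m.hom = ((H0 t).map (c.inj j)).hom ≫ _ at this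
  rw [← toH0_naturality_assoc, ← toH0_naturality_assoc, this]

lemma projective_of_addClosure {H : Type u'} [Category.{v'} H] {M : H} [Projective M] {X : H}
    (hX : AddClosure M X) : Projective X := by
  induction hX with
  | self => infer_instance
  | coproduct _ c hc ih =>
    refine ⟨fun f π _ => ⟨Cofan.IsColimit.desc hc fun j => Projective.factorThru (c.inj j ≫ f) π,
      Cofan.IsColimit.hom_ext hc _ _ fun j => ?_⟩⟩
    rw [Cofan.IsColimit.fac_assoc, Projective.factorThru_comp]
  | summand _ r ih => exact r.projective

/-- The image under `F` of a splitting of an idempotent is isomorphic to any other splitting of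
the image of that idempotent. -/
def isoOfSplittings {D : Type u} [Category.{v} D] {H : Type u'} [Category.{v'} H] {F : D ⥤ H}
    {X Y : D} {P : H} {i : X ⟶ Y} {p : Y ⟶ X} (hip : i ≫ p = 𝟙 X) {r : Retract P (F.obj Y)}
    (hpi : F.map (p ≫ i) = r.r ≫ r.i) : F.obj X ≅ P where
  hom := F.map i ≫ r.r
  inv := r.i ≫ F.map p
  hom_inv_id := by
    rw [Category.assoc, ← reassoc_of% hpi, ← F.map_comp, ← F.map_comp, Category.assoc, hip,
      Category.comp_id, hip, F.map_id]
  inv_hom_id := by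
    rw [Category.assoc, ← F.map_comp_assoc, hpi, Category.assoc, r.retract_assoc, r.retract]

/-- If every object of the heart is covered by a coproduct of copies of `T`, then a projective
object of the heart is a direct summand of some `H⁰(c.pt)` with `c` a coproduct of copies of `T`.
The corresponding idempotent lifts uniquely to `c.pt`, where it splits. -/
theorem addClosure_H0_eq_proj_and_restrictsToEquivalence [IsIdempotentComplete C] {T : C}
    (hT : aisleProjective t T)
    (hcov : ∀ P : HeartCat t, ∃ (J : Type v) (c : Cofan fun _ : J => T) (_ : IsColimit c)
      (φ : c.pt ⟶ P.obj), ∀ (Z : HeartCat t) (g : P.obj ⟶ Z.obj), φ ≫ g = 0 → g = 0) :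
    AddClosure ((H0 t).obj T) = Proj (HeartCat t) ∧
      RestrictsToEquivalence (H0 t) (AddClosure T) (Proj (HeartCat t)) := by
  have := projective_H0_obj hT
  have hret (P : HeartCat t) (hP : Projective P) : ∃ (J : Type v) (c : Cofan fun _ : J => T)
      (_ : IsColimit c), Nonempty (Retract P ((H0 t).obj c.pt)) := by
    obtain ⟨J, c, hc, φ, hφ⟩ := hcov P
    have := isLE_pt_of_isColimit (fun _ => hT.1) hc
    obtain ⟨ψ, hψ⟩ := exists_toH0_comp_eq (t := t) φ
    let π : (H0 t).obj c.pt ⟶ P := ObjectProperty.homMk ψ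
    have : Epi π := Preadditive.epi_of_cancel_zero _ fun {Z} g hg => by
      refine ObjectProperty.hom_ext _ (hφ Z g.hom ?_)
      have : ψ ≫ g.hom = 0 := congrArg (fun k => k.hom) hg
      rw [← hψ, Category.assoc, this, comp_zero]
    exact ⟨J, c, hc, ⟨⟨Projective.factorThru (𝟙 P) π, π, Projective.factorThru_comp _ _⟩⟩⟩
  refine ⟨?_, fun X => projective_H0_obj (aisleProjective_of_addClosure hT X.property), ?_⟩
  · ext P
    refine ⟨fun hP => projective_of_addClosure hP, fun hP => ?_⟩
    obtain ⟨J, c, hc, ⟨r⟩⟩ := hret P hP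
    obtain ⟨hc'⟩ := nonempty_isColimit_H0 (fun _ => hT.1) hc
    exact .summand (.coproduct (fun _ => .self) _ hc') r
  · refine @Functor.IsEquivalence.mk _ _ _ _ _ ⟨?_⟩ ⟨?_⟩ ⟨?_⟩
    · intro X Y f g h
      exact ObjectProperty.hom_ext _ (H0_map_injective (aisleProjective_of_addClosure hT X.property)
        (aisleProjective_of_addClosure hT Y.property) (congrArg (fun k => k.hom) h))
    · intro X Y φ
      obtain ⟨f, hf⟩ := H0_map_surjective (aisleProjective_of_addClosure hT X.property)
        (aisleProjective_of_addClosure hT Y.property) φ.hom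
      exact ⟨ObjectProperty.homMk f, ObjectProperty.hom_ext _ hf⟩
    · rintro ⟨P, hP⟩
      obtain ⟨J, c, hc, ⟨r⟩⟩ := hret P hP
      have hc' : AddClosure T c.pt := .coproduct (fun _ => .self) _ hc
      have hc'' := aisleProjective_of_addClosure hT hc'
      obtain ⟨e, he⟩ := H0_map_surjective hc'' hc'' (r.r ≫ r.i)
      have hee : e ≫ e = e := H0_map_injective hc'' hc'' (by
        rw [Functor.map_comp, he, Category.assoc, r.retract_assoc])
      obtain ⟨X, i, p, hip, hpi⟩ := IsIdempotentComplete.idempotents_split c.pt e hee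
      have hX : AddClosure T X := .summand hc' ⟨i, p, hip⟩
      exact ⟨⟨X, hX⟩, ⟨ObjectProperty.isoMk _
        (isoOfSplittings (F := H0 t) hip (by rw [hpi, he] : _ = r.r ≫ r.i))⟩⟩

end Aisle

/-! ### Silting objects -/

section Silting

variable {C : Type u} [Category.{v} C] [Preadditive C] [HasZeroObject C] [HasShift C ℤ]
  [∀ n : ℤ, (shiftFunctor C n).Additive] [Pretriangulated C]
  [IsTriangulated C]

omit [IsTriangulated C] in
lemma IsSilting.isLE_neg_one_iff {T : C} (hT : IsSilting T) (Y : C) :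
    hT.tStructure.IsLE Y (-1) ↔ ∀ i : ℤ, 0 ≤ i → ∀ f : T ⟶ Y⟦i⟧, f = 0 := by
  rw [← hT.tStructure.isLE_shift_iff Y (-1) (-1) 0, ← hT.tStructure.le_iff_isLE,
    show hT.tStructure.le 0 = _ from hT.1.choose_spec.1]
  have e (i j : ℤ) (h : -1 + i = j) : Y⟦(-1 : ℤ)⟧⟦i⟧ ≅ Y⟦j⟧ :=
    ((shiftFunctorAdd' C (-1) i j h).app Y).symm
  constructor
  · intro h i hi f
    rw [← cancel_mono (e (i + 1) i (by simp)).inv, zero_comp]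
    exact h (i + 1) (by simpa using by lia) _
  · intro h i hi f
    have hi' : 0 < i := hi
    rw [← cancel_mono (e i (i - 1) (by lia)).hom, zero_comp]
    exact h (i - 1) (by lia) _

omit [IsTriangulated C] in
lemma IsSilting.aisleProjective {T : C} (hT : IsSilting T) : aisleProjective hT.tStructure T := by
  constructor
  · rw [← hT.tStructure.le_iff_isLE, show hT.tStructure.le 0 = _ from hT.1.choose_spec.1]
    exact hT.2
  · intro Y f hY
    rw [← cancel_mono ((shiftFunctorZero C ℤ).inv.app Y), zero_comp]
    exact (hT.isLE_neg_one_iff Y).1 hY 0 le_rfl _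

omit [IsTriangulated C] in
/-- The cone of the evaluation `∐_{T ⟶ P} T ⟶ P` lies in degrees `≤ -1`. -/
lemma IsSilting.exists_cover {T : C} (hT : IsSilting T) [HasCoproducts.{v} C]
    (P : HeartCat hT.tStructure) :
    ∃ (J : Type v) (c : Cofan fun _ : J => T) (_ : IsColimit c) (φ : c.pt ⟶ P.obj),
      ∀ (Z : HeartCat hT.tStructure) (g : P.obj ⟶ Z.obj), φ ≫ g = 0 → g = 0 := by
  let t := hT.tStructure
  let c := Cofan.mk _ (Sigma.ι fun _ : T ⟶ P.obj => T)
  have hc : IsColimit c := coproductIsCoproduct _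
  let φ : c.pt ⟶ P.obj := Cofan.IsColimit.desc hc fun f => f
  have hφ (f : T ⟶ P.obj) : c.inj f ≫ φ = f := Cofan.IsColimit.fac hc _ f
  refine ⟨_, c, hc, φ, fun Z g hg => ?_⟩
  have hcLE : t.IsLE c.pt 0 := isLE_pt_of_isColimit (fun _ => hT.aisleProjective.1) hc
  obtain ⟨W, p, δ, hW⟩ := distinguished_cocone_triangle φ
  have hφp : φ ≫ p = 0 := comp_distTriang_mor_zero₁₂ _ hW
  have hW' : t.IsLE W (-1) := by
    have : t.IsLE (c.pt⟦(1 : ℤ)⟧) (-1) := t.isLE_shift c.pt 0 1 (-1)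
    have hW0 : t.IsLE W 0 := t.isLE₂ _ (rot_of_distTriang _ hW) 0 (isLE_obj_of_heart P)
      (t.isLE_of_le (c.pt⟦(1 : ℤ)⟧) (-1) 0)
    rw [hT.isLE_neg_one_iff]
    intro i hi f
    obtain rfl | hi := hi.eq_or_lt
    · rw [← cancel_mono ((shiftFunctorZero C ℤ).hom.app W), zero_comp]
      obtain ⟨l, hl⟩ := exists_lift_obj₂ hW (f ≫ (shiftFunctorZero C ℤ).hom.app W)
        (hT.aisleProjective.2 _ this)
      rw [← hl, ← hφ l, Category.assoc, hφp, comp_zero]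
    · rw [← t.le_iff_isLE, show t.le 0 = _ from hT.1.choose_spec.1] at hW0
      exact hW0 i hi f
  obtain ⟨l, rfl⟩ := exists_desc_obj₃ hW g hg
  rw [t.zero l (-1) 0, comp_zero]

end Silting


/-! ### Objects of the coaisle with injective cohomology -/

section Coaisle

variable {C : Type u} [Category.{v} C] [Preadditive C] [HasZeroObject C] [HasShift C ℤ]
  [∀ n : ℤ, (shiftFunctor C n).Additive] [Pretriangulated C]
  (t : TStructure C)

/-- The objects `X` of degree `≥ 0` such that `Hom(Y, X) = 0` for all `Y` of degree `≥ 1`. -/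
def coaisleInjective : ObjectProperty C :=
  fun X => t.IsGE X 0 ∧ ∀ ⦃Y : C⦄ (f : Y ⟶ X), t.IsGE Y 1 → f = 0

variable {t}

lemma coaisleInjective_of_retract {X Y : C} (r : Retract X Y) (hY : coaisleInjective t Y) :
    coaisleInjective t X := by
  have := hY.1
  refine ⟨(t.isGE_iff_orthogonal (-1) 0 (by simp) X).2 fun Z f _ => ?_, fun Z f hZ => ?_⟩
  · rw [← Category.comp_id f, ← r.retract, ← Category.assoc, t.zero (f ≫ r.i) (-1) 0, zero_comp]
  · rw [← Category.comp_id f, ← r.retract, ← Category.assoc, hY.2 (f ≫ r.i) hZ, zero_comp]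

lemma isGE_pt_of_isLimit {J : Type*} {X : J → C} (hX : ∀ j, t.IsGE (X j) 0) {c : Fan X}
    (hc : IsLimit c) : t.IsGE c.pt 0 :=
  (t.isGE_iff_orthogonal (-1) 0 (by simp) _).2 fun Z f _ =>
    Fan.IsLimit.hom_ext hc _ _ fun j => by
      have := hX j
      rw [zero_comp]
      exact t.zero _ (-1) 0

lemma coaisleInjective_of_isLimit {J : Type*} {X : J → C} (hX : ∀ j, coaisleInjective t (X j))
    {c : Fan X} (hc : IsLimit c) : coaisleInjective t c.pt :=
  ⟨isGE_pt_of_isLimit (fun j => (hX j).1) hc, fun Z f hZ =>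
    Fan.IsLimit.hom_ext hc _ _ fun j => by
      rw [zero_comp]
      exact (hX j).2 _ hZ⟩

lemma coaisleInjective_of_prodClosure {M : C} (hM : coaisleInjective t M) {X : C}
    (hX : ProdClosure M X) : coaisleInjective t X := by
  induction hX with
  | self => exact hM
  | product _ c hc ih => exact coaisleInjective_of_isLimit ih hc
  | summand _ r ih => exact coaisleInjective_of_retract r ih

variable (t)

variable [IsTriangulated C]

/-- For an object `X` of the coaisle, `τ^{≤0} X` agrees with `τ^{≥0} τ^{≤0} X`. -/
noncomputable def truncLEIsoH0 (X : C) [t.IsGE X 0] :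
    (t.truncLE 0).obj X ≅ ((H0 t).obj X).obj :=
  @asIso _ _ _ _ ((t.truncGEπ 0).app ((t.truncLE 0).obj X))
    ((t.isGE_iff_isIso_truncGEπ_app 0 ((t.truncLE 0).obj X)).1 inferInstance)

/-- The canonical morphism `τ^{≥0} τ^{≤0} X ⟶ X` for an object `X` of the coaisle. -/
noncomputable def ofH0 (X : C) [t.IsGE X 0] : ((H0 t).obj X).obj ⟶ X :=
  (truncLEIsoH0 t X).inv ≫ (t.truncLEι 0).app X

lemma ofH0_naturality {X Y : C} [t.IsGE X 0] [t.IsGE Y 0] (f : X ⟶ Y) :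
    ((H0 t).map f).hom ≫ ofH0 t Y = ofH0 t X ≫ f := by
  have h1 : (t.truncLE 0).map f ≫ (truncLEIsoH0 t Y).hom =
      (truncLEIsoH0 t X).hom ≫ ((H0 t).map f).hom := (t.truncGEπ 0).naturality ((t.truncLE 0).map f)
  have h2 := (t.truncLEι 0).naturality f
  have h3 : ((H0 t).map f).hom ≫ (truncLEIsoH0 t Y).inv =
      (truncLEIsoH0 t X).inv ≫ (t.truncLE 0).map f := by
    rw [Iso.comp_inv_eq, Category.assoc, h1, Iso.inv_hom_id_assoc]
  refine ((reassoc_of% h3) ((t.truncLEι 0).app Y)).trans ?_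
  exact (congrArg ((truncLEIsoH0 t X).inv ≫ ·) h2).trans (Category.assoc _ _ _).symm

/-- The truncation triangle `H⁰ X ⟶ X ⟶ τ^{≥1} X` of an object `X` of the coaisle. -/
lemma exists_distTriang_ofH0 (X : C) [t.IsGE X 0] :
    ∃ (W : C) (_ : t.IsGE W 1) (p : X ⟶ W) (δ : W ⟶ ((H0 t).obj X).obj⟦(1 : ℤ)⟧),
      Triangle.mk (ofH0 t X) p δ ∈ distTriang C := by
  have hT := t.triangleLEGE_distinguished 0 1 (by simp) X
  refine ⟨(t.truncGE 1).obj X, inferInstance, (t.truncGEπ 1).app X,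
    (t.truncGEδLE 0 1 (by simp)).app X ≫ (truncLEIsoH0 t X).hom⟦(1 : ℤ)⟧',
    isomorphic_distinguished _ hT _ ?_⟩
  refine Triangle.isoMk _ _ (truncLEIsoH0 t X).symm (Iso.refl _) (Iso.refl _) ?_ ?_ ?_
  · exact Category.comp_id _
  · exact (Category.comp_id _).trans (Category.id_comp _).symm
  · change ((t.truncGEδLE 0 1 (by simp)).app X ≫ (truncLEIsoH0 t X).hom⟦(1 : ℤ)⟧') ≫
      (truncLEIsoH0 t X).inv⟦(1 : ℤ)⟧' = 𝟙 _ ≫ (t.truncGEδLE 0 1 (by simp)).app X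
    rw [Category.id_comp, Category.assoc, ← Functor.map_comp, Iso.hom_inv_id,
      CategoryTheory.Functor.map_id]
    exact Category.comp_id _

variable {t}

lemma exists_comp_ofH0_eq {X Z : C} [t.IsGE X 0] [t.IsLE Z 0] (f : Z ⟶ X) :
    ∃ g : Z ⟶ ((H0 t).obj X).obj, g ≫ ofH0 t X = f := by
  obtain ⟨W, _, p, δ, hT⟩ := exists_distTriang_ofH0 t X
  exact exists_lift_obj₁ hT f (t.zero _ 0 1)

lemma comp_ofH0_injective {X Z : C} [t.IsGE X 0] [t.IsLE Z 0] {f g : Z ⟶ ((H0 t).obj X).obj}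
    (h : f ≫ ofH0 t X = g ≫ ofH0 t X) : f = g := by
  obtain ⟨W, _, p, δ, hT⟩ := exists_distTriang_ofH0 t X
  have := t.isLE_shift Z 0 1 (-1)
  obtain ⟨l, hl⟩ := exists_shift_map_eq_comp hT (f - g)
    (by rw [Preadditive.sub_comp, h, sub_self])
  rw [← sub_eq_zero]
  apply (shiftFunctor C (1 : ℤ)).map_injective
  rw [← hl, Functor.map_zero,
    t.zero_of_isLE_of_isGE l (-1) 1 (by simp) inferInstance ‹_›, zero_comp]

lemma ofH0_comp_injective {X Y : C} (hY : coaisleInjective t Y) [t.IsGE X 0] {f g : X ⟶ Y}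
    (h : ofH0 t X ≫ f = ofH0 t X ≫ g) : f = g := by
  obtain ⟨W, hW, p, δ, hT⟩ := exists_distTriang_ofH0 t X
  obtain ⟨l, hl⟩ := exists_desc_obj₃ hT (f - g) (by rw [Preadditive.comp_sub, h, sub_self])
  rw [← sub_eq_zero, ← hl, hY.2 l hW, comp_zero]

lemma exists_ofH0_comp_eq {X Y : C} (hY : coaisleInjective t Y) [t.IsGE X 0]
    (f : ((H0 t).obj X).obj ⟶ Y) : ∃ g : X ⟶ Y, ofH0 t X ≫ g = f := by
  obtain ⟨W, _, p, δ, hT⟩ := exists_distTriang_ofH0 t X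
  have : t.IsGE (W⟦(-1 : ℤ)⟧) 2 := t.isGE_shift W 1 (-1) 2
  obtain ⟨g, hg⟩ := Triangle.yoneda_exact₂ _ (inv_rot_of_distTriang _ hT) f
    (hY.2 (Y := W⟦(-1 : ℤ)⟧) _ (t.isGE_of_ge _ 1 2))
  exact ⟨g, hg.symm⟩

lemma H0_map_injective_of_coaisleInjective {X Y : C} (hX : coaisleInjective t X)
    (hY : coaisleInjective t Y) {f g : X ⟶ Y} (h : (H0 t).map f = (H0 t).map g) : f = g := by
  have := hX.1
  have := hY.1
  apply ofH0_comp_injective hY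
  rw [← ofH0_naturality, h, ofH0_naturality]

lemma H0_map_surjective_of_coaisleInjective {X Y : C} (hX : coaisleInjective t X)
    (hY : coaisleInjective t Y) (φ : (H0 t).obj X ⟶ (H0 t).obj Y) :
    ∃ f : X ⟶ Y, (H0 t).map f = φ := by
  have := hX.1
  have := hY.1
  obtain ⟨f, hf⟩ := exists_ofH0_comp_eq hY (φ.hom ≫ ofH0 t Y)
  refine ⟨f, ObjectProperty.hom_ext _ (comp_ofH0_injective ?_)⟩
  rw [ofH0_naturality, hf]

/-- The fibre of a monomorphism of the heart lies in degrees `≥ 1`. -/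
lemma exists_extension_of_mono_heart {X : C} (hX : coaisleInjective t X) {A B : HeartCat t}
    (i : A ⟶ B) [Mono i] (f : A.obj ⟶ X) : ∃ g : B.obj ⟶ X, i.hom ≫ g = f := by
  obtain ⟨W, a, δ, hT⟩ := distinguished_cocone_triangle₁ i.hom
  have : t.IsGE (B.obj⟦(-1 : ℤ)⟧) 1 := t.isGE_shift B.obj 0 (-1) 1
  have : t.IsGE W 0 := t.isGE₂ _ (inv_rot_of_distTriang _ hT) 0
    (t.isGE_of_ge (B.obj⟦(-1 : ℤ)⟧) 0 1) (isGE_obj_of_heart A)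
  have ha : (t.truncLEι 0).app W ≫ a = 0 := by
    let K : HeartCat t :=
      ⟨(t.truncLE 0).obj W, (t.mem_heart_iff _).2 ⟨inferInstance, inferInstance⟩⟩
    let k : K ⟶ A := ObjectProperty.homMk ((t.truncLEι 0).app W ≫ a)
    have hk : k = 0 := by
      rw [← cancel_mono i, zero_comp]
      have : a ≫ i.hom = 0 := comp_distTriang_mor_zero₁₂ _ hT
      apply ObjectProperty.hom_ext
      change ((t.truncLEι 0).app W ≫ a) ≫ i.hom = 0
      rw [Category.assoc, this, comp_zero]
    exact congrArg (fun k => k.hom) hk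
  obtain ⟨l, hl⟩ := Triangle.coyoneda_exact₂ _ (inv_rot_of_distTriang _ hT) _ ha
  have hl0 : l = 0 := t.zero_of_isLE_of_isGE (Y := B.obj⟦(-1 : ℤ)⟧) l 0 1 (by simp)
    inferInstance ‹_›
  have hW : t.IsGE W 1 := by
    rw [t.isGE_iff_isZero_truncLE_obj 0 1 (by simp), IsZero.iff_id_eq_zero]
    apply t.to_truncLE_obj_ext
    rw [zero_comp, Category.id_comp, hl, hl0]
    exact zero_comp
  exact exists_desc_obj₃ hT f (hX.2 _ hW)

lemma injective_H0_obj {X : C} (hX : coaisleInjective t X) : Injective ((H0 t).obj X) where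
  factors {A B} f i _ := by
    have := hX.1
    obtain ⟨g, hg⟩ := exists_extension_of_mono_heart hX i (f.hom ≫ ofH0 t X)
    obtain ⟨k, hk⟩ := exists_comp_ofH0_eq (t := t) g
    refine ⟨ObjectProperty.homMk k, ObjectProperty.hom_ext _ (comp_ofH0_injective ?_)⟩
    change (i.hom ≫ k) ≫ ofH0 t X = _
    rw [Category.assoc, hk, hg]

/-- `H⁰` preserves products of objects of the coaisle, being a right adjoint there. -/
lemma nonempty_isLimit_H0 {J : Type*} {X : J → C} (hX : ∀ j, t.IsGE (X j) 0) {c : Fan X}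
    (hc : IsLimit c) : Nonempty (IsLimit (Fan.mk ((H0 t).obj c.pt)
      fun j => (H0 t).map (c.proj j) : Fan fun j => (H0 t).obj (X j))) := by
  have := isGE_pt_of_isLimit hX hc
  have hex (s : Fan fun j => (H0 t).obj (X j)) : ∃ g : s.pt ⟶ (H0 t).obj c.pt,
      ∀ j, g ≫ (H0 t).map (c.proj j) = s.proj j := by
    obtain ⟨g, hg⟩ := exists_comp_ofH0_eq (t := t)
      (Fan.IsLimit.lift hc fun j => (s.proj j).hom ≫ ofH0 t (X j))
    refine ⟨ObjectProperty.homMk g, fun j =>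
      ObjectProperty.hom_ext _ (comp_ofH0_injective (X := X j) ?_)⟩
    change (g ≫ ((H0 t).map (c.proj j)).hom) ≫ ofH0 t (X j) = _
    rw [Category.assoc, ofH0_naturality, reassoc_of% hg, Fan.IsLimit.fac]
  refine ⟨Fan.IsLimit.mk _ (fun s => (hex s).choose) (fun s => (hex s).choose_spec)
    fun s m hm => ObjectProperty.hom_ext _ (comp_ofH0_injective (X := c.pt)
      (Fan.IsLimit.hom_ext hc _ _ fun j => ?_))⟩
  have := congrArg (fun k => k.hom) ((hm j).trans ((hex s).choose_spec j).symm)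
  change m.hom ≫ ((H0 t).map (c.proj j)).hom = _ ≫ ((H0 t).map (c.proj j)).hom at this
  rw [Category.assoc, Category.assoc, ← ofH0_naturality, reassoc_of% this]

lemma injective_of_prodClosure {H : Type u'} [Category.{v'} H] {M : H} [Injective M] {X : H}
    (hX : ProdClosure M X) : Injective X := by
  induction hX with
  | self => infer_instance
  | product _ c hc ih =>
    refine ⟨fun f i _ => ⟨Fan.IsLimit.lift hc fun j => Injective.factorThru (f ≫ c.proj j) i,
      Fan.IsLimit.hom_ext hc _ _ fun j => ?_⟩⟩
    rw [Category.assoc, Fan.IsLimit.fac, Injective.comp_factorThru]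
  | summand _ r ih => exact r.injective

/-- If every object of the heart embeds into a product of copies of `M`, then an injective
object of the heart is a direct summand of some `H⁰(c.pt)` with `c` a product of copies of `M`.
The corresponding idempotent lifts uniquely to `c.pt`, where it splits. -/
theorem prodClosure_H0_eq_inj_and_restrictsToEquivalence [IsIdempotentComplete C] {M : C}
    (hM : coaisleInjective t M)
    (hemb : ∀ E : HeartCat t, ∃ (J : Type v) (c : Fan fun _ : J => M) (_ : IsLimit c)
      (φ : E.obj ⟶ c.pt), ∀ (Z : HeartCat t) (g : Z.obj ⟶ E.obj), g ≫ φ = 0 → g = 0) :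
    ProdClosure ((H0 t).obj M) = Inj (HeartCat t) ∧
      RestrictsToEquivalence (H0 t) (ProdClosure M) (Inj (HeartCat t)) := by
  have := injective_H0_obj hM
  have hret (E : HeartCat t) (hE : Injective E) : ∃ (J : Type v) (c : Fan fun _ : J => M)
      (_ : IsLimit c), Nonempty (Retract E ((H0 t).obj c.pt)) := by
    obtain ⟨J, c, hc, φ, hφ⟩ := hemb E
    have := isGE_pt_of_isLimit (fun _ => hM.1) hc
    obtain ⟨ψ, hψ⟩ := exists_comp_ofH0_eq (t := t) φ
    let i : E ⟶ (H0 t).obj c.pt := ObjectProperty.homMk ψ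
    have : Mono i := Preadditive.mono_of_cancel_zero _ fun {Z} g hg => by
      refine ObjectProperty.hom_ext _ (hφ Z g.hom ?_)
      have : g.hom ≫ ψ = 0 := congrArg (fun k => k.hom) hg
      rw [← hψ, reassoc_of% this, zero_comp]
    exact ⟨J, c, hc, ⟨⟨i, Injective.factorThru (𝟙 E) i, Injective.comp_factorThru _ _⟩⟩⟩
  refine ⟨?_, fun X => injective_H0_obj (coaisleInjective_of_prodClosure hM X.property), ?_⟩
  · ext E
    refine ⟨fun hE => injective_of_prodClosure hE, fun hE => ?_⟩
    obtain ⟨J, c, hc, ⟨r⟩⟩ := hret E hE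
    obtain ⟨hc'⟩ := nonempty_isLimit_H0 (fun _ => hM.1) hc
    exact .summand (.product (fun _ => .self) _ hc') r
  · refine @Functor.IsEquivalence.mk _ _ _ _ _ ⟨?_⟩ ⟨?_⟩ ⟨?_⟩
    · intro X Y f g h
      exact ObjectProperty.hom_ext _ (H0_map_injective_of_coaisleInjective
        (coaisleInjective_of_prodClosure hM X.property)
        (coaisleInjective_of_prodClosure hM Y.property) (congrArg (fun k => k.hom) h))
    · intro X Y φ
      obtain ⟨f, hf⟩ := H0_map_surjective_of_coaisleInjective
        (coaisleInjective_of_prodClosure hM X.property)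
        (coaisleInjective_of_prodClosure hM Y.property) φ.hom
      exact ⟨ObjectProperty.homMk f, ObjectProperty.hom_ext _ hf⟩
    · rintro ⟨E, hE⟩
      obtain ⟨J, c, hc, ⟨r⟩⟩ := hret E hE
      have hc' : ProdClosure M c.pt := .product (fun _ => .self) _ hc
      have hc'' := coaisleInjective_of_prodClosure hM hc'
      obtain ⟨e, he⟩ := H0_map_surjective_of_coaisleInjective hc'' hc'' (r.r ≫ r.i)
      have hee : e ≫ e = e := H0_map_injective_of_coaisleInjective hc'' hc'' (by
        rw [Functor.map_comp, he, Category.assoc, r.retract_assoc])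
      obtain ⟨X, i, p, hip, hpi⟩ := IsIdempotentComplete.idempotents_split c.pt e hee
      have hX : ProdClosure M X := .summand hc' ⟨i, p, hip⟩
      exact ⟨⟨X, hX⟩, ⟨ObjectProperty.isoMk _
        (isoOfSplittings (F := H0 t) hip (by rw [hpi, he] : _ = r.r ≫ r.i))⟩⟩

end Coaisle

/-! ### Cosilting objects -/

section Cosilting

variable {C : Type u} [Category.{v} C] [Preadditive C] [HasZeroObject C] [HasShift C ℤ]
  [∀ n : ℤ, (shiftFunctor C n).Additive] [Pretriangulated C]

lemma IsCosilting.isGE_zero_iff {M : C} (hM : IsCosilting M) (Y : C) :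
    hM.tStructure.IsGE Y 0 ↔ ∀ i : ℤ, 0 < i → ∀ f : Y ⟶ M⟦i⟧, f = 0 := by
  rw [← hM.tStructure.ge_iff_isGE, show hM.tStructure.ge 0 = _ from hM.1.choose_spec.2]
  rfl

lemma IsCosilting.eq_zero_of_isGE {M : C} (hM : IsCosilting M) {Y : C} {n i : ℤ}
    (hY : hM.tStructure.IsGE Y n) (hi : -n < i) (f : Y ⟶ M⟦i⟧) : f = 0 := by
  let e : M⟦i⟧⟦n⟧ ≅ M⟦i + n⟧ := ((shiftFunctorAdd' C i n (i + n) rfl).app M).symm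
  apply (shiftFunctor C n).map_injective
  rw [Functor.map_zero, ← cancel_mono e.hom, zero_comp]
  exact (hM.isGE_zero_iff _).1 (hM.tStructure.isGE_shift Y n n 0) _ (by lia) _

lemma IsCosilting.coaisleInjective {M : C} (hM : IsCosilting M) :
    coaisleInjective hM.tStructure M := by
  refine ⟨(hM.isGE_zero_iff M).2 hM.2, fun Y f hY => ?_⟩
  rw [← cancel_mono ((shiftFunctorZero C ℤ).inv.app M), zero_comp]
  exact hM.eq_zero_of_isGE hY (by simp) _

/-- The cone of the coevaluation `E ⟶ ∏_{E ⟶ M} M` lies in degrees `≥ 0`. -/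
lemma IsCosilting.exists_embedding {M : C} (hM : IsCosilting M) [HasProducts.{v} C]
    (E : HeartCat hM.tStructure) :
    ∃ (J : Type v) (c : Fan fun _ : J => M) (_ : IsLimit c) (φ : E.obj ⟶ c.pt),
      ∀ (Z : HeartCat hM.tStructure) (g : Z.obj ⟶ E.obj), g ≫ φ = 0 → g = 0 := by
  let t := hM.tStructure
  let c := Fan.mk _ (Pi.π fun _ : E.obj ⟶ M => M)
  have hc : IsLimit c := productIsProduct _
  let φ : E.obj ⟶ c.pt := Fan.IsLimit.lift hc fun f => f
  have hφ (f : E.obj ⟶ M) : φ ≫ c.proj f = f := Fan.IsLimit.fac hc _ f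
  refine ⟨_, c, hc, φ, fun Z g hg => ?_⟩
  have hcGE : t.IsGE c.pt 0 := isGE_pt_of_isLimit (fun _ => hM.coaisleInjective.1) hc
  obtain ⟨W, p, δ, hW⟩ := distinguished_cocone_triangle φ
  have hδφ : δ ≫ φ⟦(1 : ℤ)⟧' = 0 := comp_distTriang_mor_zero₃₁ _ hW
  have hW0 : t.IsGE W 0 := by
    have : t.IsGE (E.obj⟦(1 : ℤ)⟧) (-1) := t.isGE_shift E.obj 0 1 (-1)
    have hW1 : t.IsGE W (-1) := t.isGE₂ _ (rot_of_distTriang _ hW) (-1)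
      (t.isGE_of_ge c.pt (-1) 0) this
    rw [hM.isGE_zero_iff]
    intro i hi f
    obtain rfl | hi : i = 1 ∨ 1 < i := by lia
    · obtain ⟨l, rfl⟩ := exists_desc_shift_obj₁ hW f
        (hM.eq_zero_of_isGE hcGE (by simp) _)
      obtain ⟨k, rfl⟩ := (shiftFunctor C (1 : ℤ)).map_surjective l
      rw [← hφ k, Functor.map_comp, reassoc_of% hδφ, zero_comp]
    · exact hM.eq_zero_of_isGE hW1 (by simpa using hi) f
  have := t.isLE_shift Z.obj 0 1 (-1)
  obtain ⟨l, hl⟩ := exists_shift_map_eq_comp hW g hg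
  apply (shiftFunctor C (1 : ℤ)).map_injective
  rw [← hl, Functor.map_zero, t.zero_of_isLE_of_isGE l (-1) 0 (by simp) this hW0, zero_comp]

end Cosilting

end SiltingTheory

theorem mainTheorem10 {𝒯 : Type u} [Category.{v} 𝒯] [Preadditive 𝒯] [HasZeroObject 𝒯]
    [HasShift 𝒯 ℤ] [∀ n : ℤ, (shiftFunctor 𝒯 n).Additive] [Pretriangulated 𝒯] [IsTriangulated 𝒯]
    [SiltingTheory.IsCompactlyGenerated 𝒯] :
    (∀ (T : 𝒯) (hT : SiltingTheory.IsSilting T),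
      SiltingTheory.AddClosure ((SiltingTheory.H0 hT.tStructure).obj T) =
        SiltingTheory.Proj (SiltingTheory.HeartCat hT.tStructure) ∧
      SiltingTheory.RestrictsToEquivalence (SiltingTheory.H0 hT.tStructure)
        (SiltingTheory.AddClosure T) (SiltingTheory.Proj (SiltingTheory.HeartCat hT.tStructure))) ∧
    (∀ (C : 𝒯) (hC : SiltingTheory.IsCosilting C),
      SiltingTheory.ProdClosure ((SiltingTheory.H0 hC.tStructure).obj C) =
        SiltingTheory.Inj (SiltingTheory.HeartCat hC.tStructure) ∧
      SiltingTheory.RestrictsToEquivalence (SiltingTheory.H0 hC.tStructure)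
        (SiltingTheory.ProdClosure C) (SiltingTheory.Inj (SiltingTheory.HeartCat hC.tStructure))) := by
  have := SiltingTheory.IsCompactlyGenerated.hasCoproducts (C := 𝒯)
  have := SiltingTheory.IsCompactlyGenerated.hasProducts (C := 𝒯)
  have := SiltingTheory.IsCompactlyGenerated.hasCoproductsOfShape_nat (C := 𝒯)
  have := SiltingTheory.isIdempotentComplete_of_hasCoproductsOfShape_nat (C := 𝒯)
  exact ⟨fun T hT => SiltingTheory.addClosure_H0_eq_proj_and_restrictsToEquivalence
      hT.aisleProjective hT.exists_cover,
    fun C hC => SiltingTheory.prodClosure_H0_eq_inj_and_restrictsToEquivalence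
      hC.coaisleInjective hC.exists_embedding⟩
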